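/- Let $t\ge 1$ be an integer and let $\overrightarrow{P_3}(t)$ be the $t$-blow-up of the directed path $\overrightarrow{P_3}$ on three vertices, that is, the oriented graph whose vertex set is the union of three disjoint sets $A,B,C$ of size $t$ and whose arcs are all pairs $(a,b)$ with $a\in A$, $b\in B$ and all pairs $(b,c)$ with $b\in B$, $c\in C$. An oriented graph is a finite digraph without loops that contains at most one of the arcs $(u,v)$, $(v,u)$ for any two vertices $u,v$; it is $\overrightarrow{P_3}(t)$-free if it does not contain $\overrightarrow{P_3}(t)$ as a (not necessarily induced) subgraph. **Theorem 3.1.** For every $t\ge 1$ and every $\varepsilon>0$ there exist $\delta>0$ and $N$ such that the following holds for every $n\ge N$. If $G$ is a $\overrightarrow{P_3}(t)$-free oriented graph on $n$ vertices with at least $n^2/4-\delta n^2$ arcs, then the vertex set of $G$ can be partitioned into sets $U$ and $W$ with $|U|=\lfloor n/2\rfloor$ and $|W|=\lceil n/2\rceil$ such that $G$ can be turned into the antidirected complete bipartite graph $K_{\lfloor n/2\rfloor,\lceil n/2\rceil}$ on $U\cup W$, whose arcs are exactly the pairs $(u,w)$ with $u\in U$, $w\in W$, by deleting and adding at most $\varepsilon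 n^2$ arcs in total (reorienting an arc being counted as one deletion and one addition). -/

import Mathlib

namespace Digraph

/-- An oriented graph: no loops, and at most one of the arcs `uv`, `vu` for each pair
(taking `u = v` in the condition shows that there are no loops). -/
def IsOriented {V : Type*} (G : Digraph V) : Prop :=
  ∀ u v, G.Adj u v → ¬ G.Adj v u

/-- `G` contains `F` as a (not necessarily induced) subgraph. -/
def ContainsCopy {V W : Type*} (G : Digraph V) (F : Digraph W) : Prop :=
  ∃ f : W → V, Function.Injective f ∧ ∀ a b, F.Adj a b → G.Adj (f a) (f b)

/-- `G` is `F`-free. -/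
def IsFreeOf {V W : Type*} (G : Digraph V) (F : Digraph W) : Prop :=
  ¬ G.ContainsCopy F

/-- The directed path on `k` vertices, with the arcs `0 → 1 → ⋯ → k - 1`. -/
def dirPath (k : ℕ) : Digraph (Fin k) where
  Adj i j := (i : ℕ) + 1 = (j : ℕ)

/-- The blow-up `F(t)`: each vertex of `F` is replaced by `t` independent vertices, and each arc
of `F` by all `t²` arcs between the two classes, in the same direction. -/
def blowUp {W : Type*} (F : Digraph W) (t : ℕ) : Digraph (W × Fin t) where
  Adj p q := F.Adj p.1 q.1

/-- The complete bipartite graph with parts `U` and the complement of `U`, with its antidirected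
orientation in which every vertex of `U` is a source and every other vertex is a sink. -/
def antidirectedBipartite {V : Type*} (U : Finset V) : Digraph V where
  Adj u v := u ∈ U ∧ v ∉ U

/-- The set of arcs. -/
def arcs {V : Type*} (G : Digraph V) : Set (V × V) :=
  {p | G.Adj p.1 p.2}

/-- The number of single-arc deletions and additions that turn `G` into `H`: the arcs of `G` that
are not in `H` plus the arcs of `H` that are not in `G`. Reorienting an arc is
counted as a deletion and an addition, so this is at least the number of deletions, additions and
reorientations that are needed, and at most twice that number. -/
noncomputable def editCost {V : Type*} (G H : Digraph V) : ℕ :=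
  (G.arcs \ H.arcs).ncard + (H.arcs \ G.arcs).ncard

end Digraph

/-!
In a `P₃(t)`-free digraph only boundedly many vertices have both in- and out-degree linear in `n`:
a Kővári–Sós–Turán count of the pairs of `3t`-sets inside the in- and the out-neighbourhood would
otherwise produce `3t`-sets `A → B → C`, from which disjoint `t`-subsets can be chosen. Hence almost
every vertex is nearly a source or nearly a sink. Put into `U` the vertices whose out-degree is at
least their in-degree; all but `o(n²)` arcs then go from `U` to its complement. As there are at
least `n²/4 - δn²` arcs while `|U| |Uᶜ| = n²/4 - (|U| - n/2)²`, almost no pair of `U × Uᶜ` is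
missing and `|U|` is close to `n/2`, so moving few vertices balances the partition.
-/

namespace PathBlowUp

open Digraph Finset
open scoped symmDiff

/-- The classes need not be disjoint: each is so large that Hall's theorem picks disjoint
`t`-subsets. -/
theorem containsCopy_blowUp_of_card_mul_le {V W : Type*} [Fintype W] {G : Digraph V}
    {F : Digraph W} {t : ℕ} (P : W → Finset V) (hcard : ∀ i, Fintype.card W * t ≤ #(P i))
    (hadj : ∀ i j, F.Adj i j → ∀ u ∈ P i, ∀ v ∈ P j, G.Adj u v) :
    G.ContainsCopy (F.blowUp t) := by
  classical
  obtain ⟨f, hf, hfP⟩ : ∃ f : W × Fin t → V, f.Injective ∧ ∀ p, f p ∈ P p.1 := by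
    refine (all_card_le_biUnion_card_iff_exists_injective fun p : W × Fin t => P p.1).mp fun s => ?_
    obtain rfl | ⟨p, hp⟩ := s.eq_empty_or_nonempty
    · simp only [card_empty, zero_le]
    calc #s ≤ Fintype.card (W × Fin t) := card_le_univ s
      _ = Fintype.card W * t := by rw [Fintype.card_prod, Fintype.card_fin]
      _ ≤ #(P p.1) := hcard p.1
      _ ≤ #(s.biUnion fun q => P q.1) := card_le_card (subset_biUnion_of_mem (fun q => P q.1) hp)
  exact ⟨f, hf, fun p q hpq => hadj p.1 q.1 hpq _ (hfP p) _ (hfP q)⟩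

theorem containsCopy_blowUp_dirPath_three {V : Type*} {G : Digraph V} {t : ℕ} {A B C : Finset V}
    (hA : 3 * t ≤ #A) (hB : 3 * t ≤ #B) (hC : 3 * t ≤ #C)
    (hAB : ∀ a ∈ A, ∀ b ∈ B, G.Adj a b) (hBC : ∀ b ∈ B, ∀ c ∈ C, G.Adj b c) :
    G.ContainsCopy ((dirPath 3).blowUp t) := by
  refine containsCopy_blowUp_of_card_mul_le ![A, B, C] ?_ ?_
  · simpa [Fin.forall_fin_succ] using ⟨hA, hB, hC⟩
  · simpa [Fin.forall_fin_succ, dirPath] using ⟨hAB, hBC⟩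

theorem sum_le_card_ge_mul_add {ι : Type*} [Fintype ι] {f : ι → ℝ} {b c : ℝ} (hc : 0 ≤ c)
    (hf : ∀ i, f i ≤ b) : ∑ i, f i ≤ #{i | c ≤ f i} * b + Fintype.card ι * c := by
  have hpointwise (i : ι) : f i ≤ (if c ≤ f i then b else 0) + c := by
    split_ifs with hi
    · exact le_add_of_le_of_nonneg (hf i) hc
    · linarith
  refine (sum_le_sum fun i _ => hpointwise i).trans_eq ?_
  rw [sum_add_distrib, ← sum_filter, sum_const, sum_const, card_univ, nsmul_eq_mul, nsmul_eq_mul]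

variable {V : Type*} [Fintype V]

section Semidegree

open scoped Classical in
/-- The out-neighbourhood of a vertex. -/
noncomputable def outNbrs (G : Digraph V) (v : V) : Finset V := {w | G.Adj v w}

open scoped Classical in
/-- The in-neighbourhood of a vertex. -/
noncomputable def inNbrs (G : Digraph V) (v : V) : Finset V := {u | G.Adj u v}

/-- The smaller of the in- and the out-degree of a vertex: it measures how far the vertex is from
being a source or a sink. -/
noncomputable def minSemidegree (G : Digraph V) (v : V) : ℕ := min #(inNbrs G v) #(outNbrs G v)

@[simp]
theorem mem_outNbrs {G : Digraph V} {v w : V} : w ∈ outNbrs G v ↔ G.Adj v w := by simp [outNbrs]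

@[simp]
theorem mem_inNbrs {G : Digraph V} {u v : V} : u ∈ inNbrs G v ↔ G.Adj u v := by simp [inNbrs]

theorem minSemidegree_le_card (G : Digraph V) (v : V) : minSemidegree G v ≤ Fintype.card V :=
  (min_le_left _ _).trans (card_le_univ _)

variable {G : Digraph V} {t : ℕ}

theorem card_subset_inNbrs_subset_outNbrs_le [DecidableEq V]
    (hfree : G.IsFreeOf ((dirPath 3).blowUp t)) {A C : Finset V} (hA : 3 * t ≤ #A)
    (hC : 3 * t ≤ #C) : #{b | A ⊆ inNbrs G b ∧ C ⊆ outNbrs G b} ≤ 3 * t := by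
  by_contra! hB
  refine hfree (containsCopy_blowUp_dirPath_three hA hB.le hC ?_ ?_)
  · exact fun a ha b hb => mem_inNbrs.mp ((mem_filter.mp hb).2.1 ha)
  · exact fun b hb c hc => mem_outNbrs.mp ((mem_filter.mp hb).2.2 hc)

theorem card_minSemidegree_ge_mul_choose_sq_le (hfree : G.IsFreeOf ((dirPath 3).blowUp t))
    (k : ℕ) : #{v | k ≤ minSemidegree G v} * k.choose (3 * t) ^ 2
      ≤ (Fintype.card V).choose (3 * t) ^ 2 * (3 * t) := by
  classical
  let pairs : Finset (Finset V × Finset V) := powersetCard (3 * t) univ ×ˢ powersetCard (3 * t) univ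
  have hpairs : #pairs = (Fintype.card V).choose (3 * t) ^ 2 := by
    rw [card_product, card_powersetCard, card_univ, sq]
  rw [← hpairs]
  refine card_mul_le_card_mul (fun b p => p.1 ⊆ inNbrs G b ∧ p.2 ⊆ outNbrs G b)
    (fun b hb => ?_) fun p hp => ?_
  · obtain ⟨hin, hout⟩ := le_min_iff.mp (mem_filter.mp hb).2
    calc k.choose (3 * t) ^ 2
        ≤ (#(inNbrs G b)).choose (3 * t) * (#(outNbrs G b)).choose (3 * t) := by
          rw [sq]; gcongr
      _ = #(powersetCard (3 * t) (inNbrs G b) ×ˢ powersetCard (3 * t) (outNbrs G b)) := by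
          rw [card_product, card_powersetCard, card_powersetCard]
      _ ≤ #(pairs.bipartiteAbove (fun b p => p.1 ⊆ inNbrs G b ∧ p.2 ⊆ outNbrs G b) b) := by
          refine card_le_card fun p hp => ?_
          simp only [mem_product, mem_powersetCard] at hp
          simp [pairs, bipartiteAbove, hp]
  · simp only [pairs, mem_product, mem_powersetCard_univ] at hp
    refine (card_le_card ?_).trans
      (card_subset_inNbrs_subset_outNbrs_le hfree hp.1.ge hp.2.ge)
    exact filter_subset_filter _ (subset_univ _)

theorem card_minSemidegree_ge_mul_pow_le (hfree : G.IsFreeOf ((dirPath 3).blowUp t)) (k : ℕ) :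
    #{v | k ≤ minSemidegree G v} * (k + 1 - 3 * t) ^ (2 * (3 * t))
      ≤ 3 * t * Fintype.card V ^ (2 * (3 * t)) := by
  have hcount := card_minSemidegree_ge_mul_choose_sq_le hfree k
  set s := 3 * t
  set n := Fintype.card V
  have hk : (k + 1 - s) ^ s ≤ s.factorial * k.choose s := by
    rw [← Nat.descFactorial_eq_factorial_mul_choose]
    exact Nat.pow_sub_le_descFactorial k s
  have hn : s.factorial * n.choose s ≤ n ^ s := by
    rw [← Nat.descFactorial_eq_factorial_mul_choose]
    exact Nat.descFactorial_le_pow n s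
  calc #{v | k ≤ minSemidegree G v} * (k + 1 - s) ^ (2 * s)
      = #{v | k ≤ minSemidegree G v} * ((k + 1 - s) ^ s) ^ 2 := by rw [← pow_mul, mul_comm s 2]
    _ ≤ #{v | k ≤ minSemidegree G v} * (s.factorial * k.choose s) ^ 2 := by gcongr
    _ = s.factorial ^ 2 * (#{v | k ≤ minSemidegree G v} * k.choose s ^ 2) := by ring
    _ ≤ s.factorial ^ 2 * (n.choose s ^ 2 * s) := by gcongr
    _ = s * (s.factorial * n.choose s) ^ 2 := by ring
    _ ≤ s * (n ^ s) ^ 2 := by gcongr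
    _ = s * n ^ (2 * s) := by rw [← pow_mul, mul_comm s 2]

theorem exists_card_minSemidegree_ge_le (t : ℕ) {η : ℝ} (hη : 0 < η) :
    ∃ M : ℝ, ∀ (V : Type*) [Fintype V] (G : Digraph V), G.IsFreeOf ((dirPath 3).blowUp t) →
      (#{v | η * Fintype.card V ≤ minSemidegree G v} : ℝ) ≤ M := by
  set s := 3 * t
  refine ⟨max (2 * s / η) (s / (η / 2) ^ (2 * s)), fun V _ G hfree => ?_⟩
  set n := Fintype.card V
  set S : Finset V := {v | η * n ≤ minSemidegree G v}
  obtain hsmall | hlarge := le_or_gt (n : ℝ) (2 * s / η)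
  · exact (Nat.cast_le.mpr (card_le_univ S)).trans (hsmall.trans (le_max_left _ _))
  refine le_max_of_le_right ((le_div_iff₀ (by positivity)).mpr ?_)
  have hn₀ : (0 : ℝ) < n := lt_of_le_of_lt (by positivity) hlarge
  let k := ⌈η * n⌉₊
  have hS : S = ({v | k ≤ minSemidegree G v} : Finset V) := by simp only [S, k, Nat.ceil_le]
  have hbase : η / 2 * n ≤ ((k + 1 - s : ℕ) : ℝ) := by
    have hkn : η * n ≤ k := Nat.le_ceil _
    have hsn : 2 * s < n * η := (div_lt_iff₀ hη).mp hlarge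
    have hsub : (k + 1 : ℝ) ≤ (k + 1 - s : ℕ) + s := mod_cast le_tsub_add
    linarith
  have hcount : (#S : ℝ) * ((k + 1 - s : ℕ) : ℝ) ^ (2 * s) ≤ s * (n : ℝ) ^ (2 * s) := by
    rw [hS]
    exact mod_cast card_minSemidegree_ge_mul_pow_le hfree k
  have hscaled : #S * (η / 2) ^ (2 * s) * (n : ℝ) ^ (2 * s) ≤ s * (n : ℝ) ^ (2 * s) :=
    calc #S * (η / 2) ^ (2 * s) * (n : ℝ) ^ (2 * s) = #S * (η / 2 * n) ^ (2 * s) := by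
          rw [mul_pow, mul_assoc]
      _ ≤ #S * ((k + 1 - s : ℕ) : ℝ) ^ (2 * s) := by gcongr
      _ ≤ s * (n : ℝ) ^ (2 * s) := hcount
  exact le_of_mul_le_mul_right hscaled (by positivity)

theorem exists_sum_minSemidegree_le (t : ℕ) {η : ℝ} (hη : 0 < η) :
    ∃ N : ℕ, ∀ (V : Type*) [Fintype V] (G : Digraph V), N ≤ Fintype.card V →
      G.IsFreeOf ((dirPath 3).blowUp t) →
      ((∑ v, minSemidegree G v : ℕ) : ℝ) ≤ η * (Fintype.card V : ℝ) ^ 2 := by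
  obtain ⟨M, hM⟩ := exists_card_minSemidegree_ge_le t (half_pos hη)
  obtain ⟨N, hN⟩ := exists_nat_ge (M / (η / 2))
  refine ⟨N, fun V _ G hn hfree => ?_⟩
  set n := Fintype.card V
  have hMn : M ≤ η / 2 * n := by
    rw [← div_le_iff₀' (half_pos hη)]
    exact hN.trans (mod_cast hn)
  calc ((∑ v, minSemidegree G v : ℕ) : ℝ) = ∑ v, (minSemidegree G v : ℝ) := Nat.cast_sum _ _
    _ ≤ #{v | η / 2 * n ≤ minSemidegree G v} * n + n * (η / 2 * n) :=
        sum_le_card_ge_mul_add (by positivity) fun v => mod_cast minSemidegree_le_card G v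
    _ ≤ η / 2 * n * n + n * (η / 2 * n) := by gcongr; exact (hM V G hfree).trans hMn
    _ = η * n ^ 2 := by ring

/-- The vertices whose out-degree is at least their in-degree, the natural candidate for the class
of sources in a nearby antidirected complete bipartite graph. -/
noncomputable def sourceSide (G : Digraph V) : Finset V := {v | #(inNbrs G v) ≤ #(outNbrs G v)}

theorem ncard_arcs_sdiff_sourceSide_le (G : Digraph V) :
    (G.arcs \ (antidirectedBipartite (sourceSide G)).arcs).ncard ≤ ∑ v, minSemidegree G v := by
  classical
  let minArcs (v : V) : Finset (V × V) :=
    if v ∈ sourceSide G then inNbrs G v ×ˢ {v} else {v} ×ˢ outNbrs G v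
  have hcard (v : V) : #(minArcs v) = minSemidegree G v := by
    by_cases hv : v ∈ sourceSide G
    · have hle : #(inNbrs G v) ≤ #(outNbrs G v) := by simpa [sourceSide] using hv
      simp [minArcs, hv, minSemidegree, hle]
    · have hlt : #(outNbrs G v) < #(inNbrs G v) := by simpa [sourceSide] using hv
      simp [minArcs, hv, minSemidegree, hlt.le]
  have hsub : G.arcs \ (antidirectedBipartite (sourceSide G)).arcs
      ⊆ (univ.biUnion minArcs : Finset (V × V)) := by
    rintro ⟨u, w⟩ ⟨huw : G.Adj u w, hbad : ¬(u ∈ sourceSide G ∧ w ∉ sourceSide G)⟩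
    rw [mem_coe, mem_biUnion]
    by_cases hu : u ∈ sourceSide G
    · have hw : w ∈ sourceSide G := by tauto
      exact ⟨w, mem_univ w, by simp [minArcs, hw, huw]⟩
    · exact ⟨u, mem_univ u, by simp [minArcs, hu, huw]⟩
  calc (G.arcs \ (antidirectedBipartite (sourceSide G)).arcs).ncard
      ≤ #(univ.biUnion minArcs) := by
        rw [← Set.ncard_coe_finset]
        exact Set.ncard_le_ncard hsub (finite_toSet _)
    _ ≤ ∑ v, #(minArcs v) := card_biUnion_le
    _ = ∑ v, minSemidegree G v := sum_congr rfl fun v _ => hcard v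

end Semidegree

section EditCost

theorem editCost_eq_ncard_symmDiff {V : Type*} [Finite V] (G H : Digraph V) :
    G.editCost H = (G.arcs ∆ H.arcs).ncard :=
  (Set.ncard_union_eq disjoint_sdiff_sdiff).symm

theorem editCost_triangle {V : Type*} [Finite V] (G H K : Digraph V) :
    G.editCost K ≤ G.editCost H + H.editCost K := by
  simp only [editCost_eq_ncard_symmDiff]
  exact (Set.ncard_le_ncard (symmDiff_triangle _ _ _)).trans (Set.ncard_union_le _ _)

theorem ncard_arcs_antidirectedBipartite [DecidableEq V] (U : Finset V) :
    (antidirectedBipartite U).arcs.ncard = #U * #Uᶜ := by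
  have harcs : (antidirectedBipartite U).arcs = (U ×ˢ Uᶜ : Finset (V × V)) := by
    ext ⟨u, v⟩
    simp [arcs, antidirectedBipartite]
  rw [harcs, Set.ncard_coe_finset, card_product]

theorem editCost_add_sq_eq (G : Digraph V) (U : Finset V) :
    (G.editCost (antidirectedBipartite U) : ℝ) + (#U - Fintype.card V / 2 : ℝ) ^ 2
      = (Fintype.card V : ℝ) ^ 2 / 4 - G.arcs.ncard
        + 2 * (G.arcs \ (antidirectedBipartite U).arcs).ncard := by
  classical
  have hG : ((G.arcs ∩ (antidirectedBipartite U).arcs).ncard : ℝ)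
      + (G.arcs \ (antidirectedBipartite U).arcs).ncard = G.arcs.ncard :=
    mod_cast Set.ncard_inter_add_ncard_sdiff_eq_ncard _ _
  have hK : ((G.arcs ∩ (antidirectedBipartite U).arcs).ncard : ℝ)
      + ((antidirectedBipartite U).arcs \ G.arcs).ncard = #U * #Uᶜ := by
    rw [Set.inter_comm]
    exact mod_cast (Set.ncard_inter_add_ncard_sdiff_eq_ncard _ _).trans
      (ncard_arcs_antidirectedBipartite U)
  have hcompl : (#Uᶜ : ℝ) = Fintype.card V - #U :=
    eq_sub_of_add_eq' (mod_cast card_add_card_compl U)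
  rw [hcompl] at hK
  rw [editCost, Nat.cast_add]
  linear_combination hK - hG

theorem editCost_antidirectedBipartite_le [DecidableEq V] (U W : Finset V) :
    (antidirectedBipartite U).editCost (antidirectedBipartite W)
      ≤ 2 * (#(U ∆ W) * Fintype.card V) := by
  have hsub : (antidirectedBipartite U).arcs ∆ (antidirectedBipartite W).arcs
      ⊆ ((U ∆ W) ×ˢ univ ∪ univ ×ˢ (U ∆ W) : Finset (V × V)) := by
    rintro ⟨u, v⟩
    simp only [arcs, antidirectedBipartite, Set.mem_symmDiff, Set.mem_ofPred_eq, mem_coe, mem_union,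
      mem_product, mem_symmDiff, mem_univ]
    tauto
  calc (antidirectedBipartite U).editCost (antidirectedBipartite W)
      ≤ #((U ∆ W) ×ˢ univ ∪ univ ×ˢ (U ∆ W) : Finset (V × V)) := by
        rw [editCost_eq_ncard_symmDiff, ← Set.ncard_coe_finset]
        exact Set.ncard_le_ncard hsub (finite_toSet _)
    _ ≤ #((U ∆ W) ×ˢ (univ : Finset V)) + #((univ : Finset V) ×ˢ (U ∆ W)) := card_union_le _ _
    _ = 2 * (#(U ∆ W) * Fintype.card V) := by
        rw [card_product, card_product, card_univ]
        ring

theorem exists_card_eq_card_symmDiff_eq [DecidableEq V] (U : Finset V) {m : ℕ}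
    (hm : m ≤ Fintype.card V) : ∃ W : Finset V, #W = m ∧ (#(U ∆ W) : ℝ) = |(#U : ℝ) - m| := by
  obtain hmU | hUm := le_total m #U
  · obtain ⟨W, hWU, rfl⟩ := exists_subset_card_eq hmU
    refine ⟨W, rfl, ?_⟩
    rw [symmDiff_of_ge hWU, cast_card_sdiff hWU, abs_of_nonneg (by simpa using hmU)]
  · obtain ⟨W, hUW, -, rfl⟩ := exists_subsuperset_card_eq (subset_univ U) hUm hm
    refine ⟨W, rfl, ?_⟩
    rw [symmDiff_of_le hUW, cast_card_sdiff hUW, abs_sub_comm, abs_of_nonneg (by simpa using hUm)]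

theorem exists_card_eq_half_editCost_antidirectedBipartite_le (U : Finset V) :
    ∃ W : Finset V, #W = Fintype.card V / 2 ∧
      ((antidirectedBipartite U).editCost (antidirectedBipartite W) : ℝ)
        ≤ (2 * |(#U : ℝ) - Fintype.card V / 2| + 1) * Fintype.card V := by
  classical
  obtain ⟨W, hW, hdist⟩ := exists_card_eq_card_symmDiff_eq U (Nat.div_le_self (Fintype.card V) 2)
  refine ⟨W, hW, ?_⟩
  set n := Fintype.card V
  have hround : |(n / 2 : ℝ) - (n / 2 : ℕ)| ≤ 1 / 2 := by
    have hlower : (2 * (n / 2 : ℕ) : ℝ) ≤ n := mod_cast Nat.mul_div_le n 2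
    have hupper : (n : ℝ) ≤ 2 * (n / 2 : ℕ) + 1 := by norm_cast; lia
    rw [abs_le]
    constructor <;> linarith
  calc ((antidirectedBipartite U).editCost (antidirectedBipartite W) : ℝ)
      ≤ 2 * (#(U ∆ W) * n) := mod_cast editCost_antidirectedBipartite_le U W
    _ = 2 * |(#U : ℝ) - (n / 2 : ℕ)| * n := by rw [hdist, mul_assoc]
    _ ≤ 2 * (|(#U : ℝ) - n / 2| + |(n / 2 : ℝ) - (n / 2 : ℕ)|) * n := by
        gcongr
        exact abs_sub_le _ _ _
    _ ≤ 2 * (|(#U : ℝ) - n / 2| + 1 / 2) * n := by gcongr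
    _ = (2 * |(#U : ℝ) - n / 2| + 1) * n := by ring

theorem exists_card_eq_half_editCost_le {G : Digraph V} {U : Finset V} {γ : ℝ} (hγ₀ : 0 ≤ γ)
    (hγ₁ : γ ≤ 1) (hγn : 1 ≤ γ * Fintype.card V)
    (hU : (G.editCost (antidirectedBipartite U) : ℝ) + (#U - Fintype.card V / 2 : ℝ) ^ 2
      ≤ γ ^ 2 * (Fintype.card V : ℝ) ^ 2) :
    ∃ W : Finset V, #W = Fintype.card V / 2 ∧
      (G.editCost (antidirectedBipartite W) : ℝ) ≤ 4 * γ * (Fintype.card V : ℝ) ^ 2 := by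
  obtain ⟨W, hW, hmove⟩ := exists_card_eq_half_editCost_antidirectedBipartite_le U
  refine ⟨W, hW, ?_⟩
  set n := Fintype.card V
  have hcost : (G.editCost (antidirectedBipartite U) : ℝ) ≤ γ * n ^ 2 :=
    calc (G.editCost (antidirectedBipartite U) : ℝ)
        ≤ γ ^ 2 * n ^ 2 := (le_add_of_nonneg_right (sq_nonneg _)).trans hU
      _ ≤ γ * n ^ 2 := by gcongr; exact pow_le_of_le_one hγ₀ hγ₁ two_ne_zero
  have hbalance : |(#U : ℝ) - n / 2| ≤ γ * n := by
    refine abs_le_of_sq_le_sq ?_ (by positivity)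
    rw [mul_pow]
    exact (le_add_of_nonneg_left (Nat.cast_nonneg _)).trans hU
  calc (G.editCost (antidirectedBipartite W) : ℝ)
      ≤ G.editCost (antidirectedBipartite U)
        + (antidirectedBipartite U).editCost (antidirectedBipartite W) :=
        mod_cast editCost_triangle _ _ _
    _ ≤ γ * n ^ 2 + (2 * |(#U : ℝ) - n / 2| + 1) * n := add_le_add hcost hmove
    _ ≤ γ * n ^ 2 + (2 * (γ * n) + γ * n) * n := by gcongr
    _ = 4 * γ * n ^ 2 := by ring

end EditCost

end PathBlowUp

open PathBlowUp in
theorem theorem3p1_general (t : ℕ) (ε : ℝ) (hε : 0 < ε) :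
    ∃ δ : ℝ, 0 < δ ∧ ∃ N : ℕ, ∀ (V : Type*) [Fintype V] (G : Digraph V),
      N ≤ Fintype.card V →
      G.IsFreeOf ((Digraph.dirPath 3).blowUp t) →
      (Fintype.card V : ℝ) ^ 2 / 4 - δ * (Fintype.card V : ℝ) ^ 2 ≤ (G.arcs.ncard : ℝ) →
      ∃ U : Finset V, U.card = Fintype.card V / 2 ∧
        (G.editCost (Digraph.antidirectedBipartite U) : ℝ) ≤ ε * (Fintype.card V : ℝ) ^ 2 := by
  obtain ⟨γ, hγ₀, hγ₁, hγε⟩ : ∃ γ : ℝ, 0 < γ ∧ γ ≤ 1 ∧ 4 * γ ≤ ε :=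
    ⟨min ε 1 / 4, by positivity, by linarith [min_le_right ε 1], by linarith [min_le_left ε 1]⟩
  obtain ⟨N₁, hN₁⟩ := exists_sum_minSemidegree_le t (η := γ ^ 2 / 4) (by positivity)
  obtain ⟨N₂, hN₂⟩ := exists_nat_ge (1 / γ)
  refine ⟨γ ^ 2 / 2, by positivity, max N₁ N₂, fun V _ G hN hfree harcs => ?_⟩
  have hγn : 1 ≤ γ * Fintype.card V := by
    rw [← div_le_iff₀' hγ₀]
    exact hN₂.trans (mod_cast le_of_max_le_right hN)
  have hwrong : ((G.arcs \ (Digraph.antidirectedBipartite (sourceSide G)).arcs).ncard : ℝ)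
      ≤ γ ^ 2 / 4 * (Fintype.card V : ℝ) ^ 2 :=
    (Nat.cast_le.mpr (ncard_arcs_sdiff_sourceSide_le G)).trans
      (hN₁ V G (le_of_max_le_left hN) hfree)
  obtain ⟨W, hW, hcost⟩ := exists_card_eq_half_editCost_le (G := G) (U := sourceSide G)
    hγ₀.le hγ₁ hγn (by linarith [editCost_add_sq_eq G (sourceSide G)])
  exact ⟨W, hW, hcost.trans (by gcongr)⟩

theorem theorem3p1 (t : ℕ) (ht : 1 ≤ t) (ε : ℝ) (hε : 0 < ε) :
    ∃ δ : ℝ, 0 < δ ∧ ∃ N : ℕ, ∀ (V : Type*) [Fintype V] (G : Digraph V),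
      N ≤ Fintype.card V →
      G.IsOriented →
      G.IsFreeOf ((Digraph.dirPath 3).blowUp t) →
      (Fintype.card V : ℝ) ^ 2 / 4 - δ * (Fintype.card V : ℝ) ^ 2 ≤ (G.arcs.ncard : ℝ) →
      ∃ U : Finset V, U.card = Fintype.card V / 2 ∧
        (G.editCost (Digraph.antidirectedBipartite U) : ℝ) ≤ ε * (Fintype.card V : ℝ) ^ 2 := by
  obtain ⟨δ, hδ, N, h⟩ := theorem3p1_general t ε hε
  exact ⟨δ, hδ, N, fun V _ G hN _ => h V G hN⟩
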